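/- Let $n\in\mathbb N$ and let $M\in\mathbb R[x]^{n\times n}$ be a symmetric matrix whose entries are polynomials in a single variable $x$. Assume that $M$ is positive semidefinite on a neighbourhood of $0^+$, that is, there is $\varepsilon>0$ such that the real matrix $M(t)$ is positive semidefinite for every $t\in(0,\varepsilon)$. Then $M$ admits a semi-certificate of positivity at $0^+$: there are $\delta>0$, $r\in\mathbb N$, polynomials $f_1,\dots,f_r\in\mathbb R[x]$ and matrix polynomials $U_1,\dots,U_r\in\mathbb R[x]^{n\times n}$ such that $$M(x)=\sum_{j=1}^{r} f_j(x)\,U_j(x)^{T}U_j(x)\quad\text{in }\mathbb R[x]^{n\times n},$$ and $f_j(t)\ge 0$ for all $j$ and all $t\in(0,\delta)$. -/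

import Mathlib

open Polynomial Topology

/-- The value at `t` of a matrix polynomial in one variable. -/
noncomputable def MatrixPolynomial.evalAt {n : ℕ} (M : Matrix (Fin n) (Fin n) ℝ[X]) (t : ℝ) :
    Matrix (Fin n) (Fin n) ℝ :=
  M.map (Polynomial.eval t)

/-- `M` is positive semidefinite at every point of `S`. -/
def MatrixPolynomial.IsPsdOn {n : ℕ} (M : Matrix (Fin n) (Fin n) ℝ[X]) (S : Set ℝ) : Prop :=
  ∀ t ∈ S, (MatrixPolynomial.evalAt M t).PosSemidef

/-- `M` has a semi-certificate of positivity on `S`: an identity of matrix polynomials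
`M = ∑ j, f j • (U j)ᵀ * U j` (a finite sum, without denominators) in which every scalar
polynomial `f j` is nonnegative on `S`. -/
def MatrixPolynomial.HasSemiCertificateOn {n : ℕ} (M : Matrix (Fin n) (Fin n) ℝ[X])
    (S : Set ℝ) : Prop :=
  ∃ (r : ℕ) (f : Fin r → ℝ[X]) (U : Fin r → Matrix (Fin n) (Fin n) ℝ[X]),
    M = ∑ j, f j • ((U j).transpose * U j) ∧ ∀ j, ∀ t ∈ S, 0 ≤ (f j).eval t

/-- `M` has a semi-certificate of positivity at `0⁺`: one on some set that contains an
interval `(0, δ)` with `δ > 0`. -/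
def MatrixPolynomial.HasSemiCertificateAtZeroPlus {n : ℕ}
    (M : Matrix (Fin n) (Fin n) ℝ[X]) : Prop :=
  ∃ V ∈ 𝓝[>] (0 : ℝ), MatrixPolynomial.HasSemiCertificateOn M V

namespace MatrixPolynomial

open Matrix Filter

/-! ### Germs of nonnegative polynomials at `0⁺` -/

/-! Squares are split off as in Gauss diagonalisation, at the cost of a scalar factor. Write `M = d
• M'` with `M'` primitive. For any `f ≠ 0` divisible by `X`, the Chinese remainder theorem gives a
vector `v` with `q = vᵀM'v` prime to `f`. With `w = M'v`, `q • M = N + d • wwᵀ`, where `N` is again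
nonnegative, by Cauchy–Schwarz, and has `v` as an extra kernel vector. Iterating
(`exists_coprime_smul_hasSemiCertificate`) certifies `g • M` for some `g` prime to `f`. Taking `f =
X`, then `f = X * g`, yields coprime multipliers `g`, `h`, both positive at `0`. A Bézout identity
`a * g + b * h = 1` with `a`, `b` positive at `0` (`exists_bezout_nonneg`) removes the denominators.
-/

/-- `p` is nonnegative on some interval `(0, δ)`. -/
def NonnegAtZeroPlus (p : ℝ[X]) : Prop := ∀ᶠ t in 𝓝[>] (0 : ℝ), 0 ≤ p.eval t

theorem NonnegAtZeroPlus.mul {p q : ℝ[X]} (hp : NonnegAtZeroPlus p) (hq : NonnegAtZeroPlus q) :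
    NonnegAtZeroPlus (p * q) := by
  filter_upwards [hp, hq] with t h1 h2
  simpa using mul_nonneg h1 h2

theorem nonnegAtZeroPlus_of_eval_pos {p : ℝ[X]} (hp : 0 < p.eval 0) : NonnegAtZeroPlus p := by
  have h : ∀ᶠ t in 𝓝 (0 : ℝ), 0 < p.eval t := p.continuous.continuousAt.eventually_const_lt hp
  exact (h.filter_mono nhdsWithin_le_nhds).mono fun _ h => h.le

theorem eventually_eval_ne_zero {p : ℝ[X]} (hp : p ≠ 0) :
    ∀ᶠ t in 𝓝[>] (0 : ℝ), p.eval t ≠ 0 := by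
  have h : ∀ᶠ t in cofinite, p.eval t ≠ 0 := by
    have := (p.roots.toFinset.finite_toSet).eventually_cofinite_notMem
    filter_upwards [this] with t ht h0
    exact ht (by simp [hp, h0])
  exact h.filter_mono ((nhdsGT_le_nhdsNE 0).trans (nhdsNE_le_cofinite 0))

theorem NonnegAtZeroPlus.of_mul {p q : ℝ[X]} (hp : p ≠ 0) (h : NonnegAtZeroPlus p)
    (hpq : NonnegAtZeroPlus (p * q)) : NonnegAtZeroPlus q := by
  filter_upwards [h, hpq, eventually_eval_ne_zero hp] with t h1 h2 h3
  rw [eval_mul] at h2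
  exact nonneg_of_mul_nonneg_right h2 (lt_of_le_of_ne h1 h3.symm)

/-- The sign at `0⁺` is that of `r(0)`, where `p = X ^ m * r` and `r(0) ≠ 0`. -/
theorem nonnegAtZeroPlus_or_neg (p : ℝ[X]) : NonnegAtZeroPlus p ∨ NonnegAtZeroPlus (-p) := by
  by_cases hp : p = 0
  · left; simp [NonnegAtZeroPlus, hp]
  obtain ⟨r, hr, hdvd⟩ := exists_eq_pow_rootMultiplicity_mul_and_not_dvd p hp 0
  have hX : NonnegAtZeroPlus ((X - C 0) ^ p.rootMultiplicity 0) := by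
    filter_upwards [self_mem_nhdsWithin] with t ht
    simpa using pow_nonneg (le_of_lt ht) _
  have h0 : r.eval 0 ≠ 0 := fun h => hdvd (dvd_iff_isRoot.2 h)
  rcases lt_or_gt_of_ne h0 with h | h
  · right
    rw [hr, ← mul_neg]
    exact hX.mul (nonnegAtZeroPlus_of_eval_pos (by simpa using h))
  · left
    rw [hr]
    exact hX.mul (nonnegAtZeroPlus_of_eval_pos h)

theorem NonnegAtZeroPlus.eval_zero_pos {p : ℝ[X]} (hp : NonnegAtZeroPlus p)
    (h0 : p.eval 0 ≠ 0) : 0 < p.eval 0 := by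
  refine lt_of_le_of_ne ?_ h0.symm
  exact ge_of_tendsto (p.continuous.continuousAt.tendsto.mono_left nhdsWithin_le_nhds) hp

/-- Two coprime polynomials that are positive at `0` admit a Bézout identity with coefficients
positive at `0`. -/
theorem exists_bezout_nonneg {g h : ℝ[X]} (hgh : IsCoprime g h) (hg : 0 < g.eval 0)
    (hh : 0 < h.eval 0) :
    ∃ a b : ℝ[X], NonnegAtZeroPlus a ∧ NonnegAtZeroPlus b ∧ a * g + b * h = 1 := by
  obtain ⟨a, b, hab⟩ := hgh
  have h0 : a.eval 0 * g.eval 0 + b.eval 0 * h.eval 0 = 1 := by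
    simpa using congrArg (Polynomial.eval 0) hab
  -- `k` makes the first term of the identity equal to `1/2` at `0`, so the second is `1/2` as well.
  set k : ℝ := (1 / (2 * g.eval 0) - a.eval 0) / h.eval 0 with hk
  refine ⟨a + C k * h, b - C k * g, nonnegAtZeroPlus_of_eval_pos ?_,
    nonnegAtZeroPlus_of_eval_pos ?_, by linear_combination hab⟩
  · have : a.eval 0 + k * h.eval 0 = 1 / (2 * g.eval 0) := by rw [hk]; field_simp; ring
    simp only [eval_add, eval_mul, eval_C, this]
    positivity
  · have : b.eval 0 - k * g.eval 0 = 1 / (2 * h.eval 0) := by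
      rw [hk]; field_simp; linear_combination 2 * h0
    simp only [eval_sub, eval_mul, eval_C, this]
    positivity

/-! ### The cone of matrices with a semi-certificate -/

variable {n : ℕ}

theorem hasSemiCertificateAtZeroPlus_iff {M : Matrix (Fin n) (Fin n) ℝ[X]} :
    HasSemiCertificateAtZeroPlus M ↔
      ∃ (r : ℕ) (f : Fin r → ℝ[X]) (U : Fin r → Matrix (Fin n) (Fin n) ℝ[X]),
        M = ∑ j, f j • ((U j).transpose * U j) ∧ ∀ j, NonnegAtZeroPlus (f j) := by
  constructor
  · rintro ⟨V, hV, r, f, U, hM, hf⟩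
    exact ⟨r, f, U, hM, fun j => mem_of_superset hV (hf j)⟩
  · rintro ⟨r, f, U, hM, hf⟩
    exact ⟨_, eventually_all.2 hf, r, f, U, hM, fun j t ht => ht j⟩

theorem HasSemiCertificateAtZeroPlus.zero :
    HasSemiCertificateAtZeroPlus (0 : Matrix (Fin n) (Fin n) ℝ[X]) :=
  hasSemiCertificateAtZeroPlus_iff.2 ⟨0, Fin.elim0, Fin.elim0, by simp, fun j => j.elim0⟩

theorem HasSemiCertificateAtZeroPlus.add {M N : Matrix (Fin n) (Fin n) ℝ[X]}
    (hM : HasSemiCertificateAtZeroPlus M) (hN : HasSemiCertificateAtZeroPlus N) :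
    HasSemiCertificateAtZeroPlus (M + N) := by
  rw [hasSemiCertificateAtZeroPlus_iff] at *
  obtain ⟨r, f, U, rfl, hf⟩ := hM
  obtain ⟨s, g, W, rfl, hg⟩ := hN
  refine ⟨r + s, Fin.append f g, Fin.append U W, by simp [Fin.sum_univ_add], fun j => ?_⟩
  induction j using Fin.addCases <;> simp [hf, hg]

theorem HasSemiCertificateAtZeroPlus.smul {M : Matrix (Fin n) (Fin n) ℝ[X]} {p : ℝ[X]}
    (hM : HasSemiCertificateAtZeroPlus M) (hp : NonnegAtZeroPlus p) :
    HasSemiCertificateAtZeroPlus (p • M) := by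
  rw [hasSemiCertificateAtZeroPlus_iff] at *
  obtain ⟨r, f, U, rfl, hf⟩ := hM
  exact ⟨r, fun j => p * f j, U, by simp [Finset.smul_sum, mul_smul], fun j => hp.mul (hf j)⟩

theorem HasSemiCertificateAtZeroPlus.vecMulVec (w : Fin n → ℝ[X]) :
    HasSemiCertificateAtZeroPlus (vecMulVec w w) := by
  rcases n with _ | n
  · rw [Subsingleton.elim (Matrix.vecMulVec w w) 0]
    exact .zero
  -- `U` has first row `w` and all other rows zero, which needs `n > 0`.
  · refine hasSemiCertificateAtZeroPlus_iff.2 ⟨1, fun _ => 1,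
      fun _ => Matrix.vecMulVec (Pi.single 0 1) w, ?_, fun j => ?_⟩
    · ext i j
      simp [Matrix.mul_apply, Matrix.vecMulVec_apply, Pi.single_apply]
    · simp [NonnegAtZeroPlus]

/-! ### Values of the quadratic form prime to a given polynomial -/

/-- A nonzero matrix is a scalar multiple of a primitive one. -/
theorem exists_eq_smul_primitive {M : Matrix (Fin n) (Fin n) ℝ[X]} (hM : M ≠ 0) :
    ∃ (d : ℝ[X]) (M' : Matrix (Fin n) (Fin n) ℝ[X]), d ≠ 0 ∧ M = d • M' ∧
      ∀ p, Prime p → ∃ i j, ¬ p ∣ M' i j := by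
  set I : Ideal ℝ[X] := Ideal.span (Set.range fun ij : Fin n × Fin n => M ij.1 ij.2) with hI
  obtain ⟨d, hd⟩ := (IsPrincipalIdealRing.principal I).principal
  have hdvd : ∀ i j, d ∣ M i j := fun i j => by
    rw [← Ideal.mem_span_singleton]
    change M i j ∈ Submodule.span ℝ[X] {d}
    rw [← hd]
    exact Ideal.subset_span ⟨(i, j), rfl⟩
  choose M' hM' using hdvd
  have hd0 : d ≠ 0 := by
    rintro rfl
    exact hM (by ext1 i j; simp [hM'])
  refine ⟨d, Matrix.of M', hd0, by ext1 i j; simp [hM' i j], fun p hp => ?_⟩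
  by_contra! hall
  -- A prime dividing every entry of `M'` would make `d * p` divide the gcd `d` of the entries.
  have hle : I ≤ Ideal.span {d * p} := by
    rw [hI, Ideal.span_le]
    rintro _ ⟨⟨i, j⟩, rfl⟩
    rw [SetLike.mem_coe, Ideal.mem_span_singleton]
    simpa [hM' i j] using mul_dvd_mul_left d (hall i j)
  have hdI : d ∈ I := hd ▸ Submodule.mem_span_singleton_self d
  have h1 : d * p ∣ d * 1 := by simpa [Ideal.mem_span_singleton] using hle hdI
  exact hp.not_isUnit (isUnit_of_dvd_one ((mul_dvd_mul_iff_left hd0).1 h1))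

/-- Polarisation: values at basis vectors and their sums determine `2 * M i j`, and `2` is a unit.
-/
theorem exists_not_dvd_dotProduct_mulVec {M : Matrix (Fin n) (Fin n) ℝ[X]} (hM : M.IsSymm)
    {p : ℝ[X]} (hp : ∃ i j, ¬ p ∣ M i j) : ∃ v : Fin n → ℝ[X], ¬ p ∣ v ⬝ᵥ M *ᵥ v := by
  obtain ⟨i, j, hij⟩ := hp
  by_contra! h
  have h1 := h (Pi.single i 1)
  have h2 := h (Pi.single j 1)
  have h3 := h (Pi.single i 1 + Pi.single j 1)
  have hs : M j i = M i j := hM.apply i j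
  simp only [mulVec_add, add_dotProduct, dotProduct_add, mulVec_single_one,
    single_one_dotProduct, col_apply, hs] at h1 h2 h3
  have h4 : p ∣ M i j * C 2 := by
    convert dvd_sub (dvd_sub h3 h1) h2 using 1
    rw [show (C (2 : ℝ) : ℝ[X]) = 2 from rfl]
    ring
  exact hij ((IsUnit.dvd_mul_right (isUnit_C.2 (by norm_num))).1 h4)

/-- Modulo a prime `p`, the value depends only on `v` modulo `p`, so good vectors for the prime
factors of `f` can be glued. -/
theorem exists_isCoprime_dotProduct_mulVec {M : Matrix (Fin n) (Fin n) ℝ[X]} (hM : M.IsSymm)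
    (hprim : ∀ p, Prime p → ∃ i j, ¬ p ∣ M i j) {f : ℝ[X]} (hf : f ≠ 0) :
    ∃ v : Fin n → ℝ[X], IsCoprime (v ⬝ᵥ M *ᵥ v) f := by
  classical
  let s := (UniqueFactorizationMonoid.normalizedFactors f).toFinset
  have hs : ∀ p : s, Prime p.1 := fun p =>
    UniqueFactorizationMonoid.prime_of_normalized_factor _ (Multiset.mem_toFinset.1 p.2)
  have hco : Pairwise (Function.onFun IsCoprime fun p : s => Ideal.span {p.1}) := by
    intro p p' hpp
    rw [Function.onFun, Ideal.isCoprime_span_singleton_iff]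
    refine ((hs p).irreducible.coprime_iff_not_dvd).2 fun hdvd => hpp (Subtype.ext ?_)
    have hass := (hs p).irreducible.associated_of_dvd (hs p').irreducible hdvd
    rw [← UniqueFactorizationMonoid.normalize_normalized_factor _ (Multiset.mem_toFinset.1 p.2),
      ← UniqueFactorizationMonoid.normalize_normalized_factor _ (Multiset.mem_toFinset.1 p'.2)]
    exact normalize_eq_normalize_iff_associated.2 hass
  choose v hv using fun p : s => exists_not_dvd_dotProduct_mulVec hM (hprim p.1 (hs p))
  choose u hu using fun i => Ideal.exists_forall_sub_mem_ideal hco (fun p => v p i)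
  refine ⟨u, isCoprime_of_prime_dvd (fun h => hf h.2) fun p hp hpq hpf => ?_⟩
  obtain ⟨p', hp', hass⟩ :=
    UniqueFactorizationMonoid.exists_mem_normalizedFactors_of_dvd hf hp.irreducible hpf
  let P : s := ⟨p', Multiset.mem_toFinset.2 hp'⟩
  refine hv P ?_
  have key : ∀ i, p' ∣ u i - v P i := fun i =>
    Ideal.mem_span_singleton.1 (hu i P)
  have hdiff : p' ∣ u ⬝ᵥ M *ᵥ u - v P ⬝ᵥ M *ᵥ v P := by
    simp only [dotProduct, mulVec, ← Finset.sum_sub_distrib]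
    refine Finset.dvd_sum fun i _ => ?_
    have h1 : p' ∣ ∑ j, M i j * u j - ∑ j, M i j * v P j := by
      rw [← Finset.sum_sub_distrib]
      exact Finset.dvd_sum fun j _ => by
        rw [← mul_sub]; exact (key j).mul_left _
    convert dvd_add (h1.mul_left (u i)) ((key i).mul_right (∑ j, M i j * v P j)) using 1
    ring
  exact (dvd_sub_right (hass.dvd_iff_dvd_left.1 hpq)).1 hdiff

/-! ### Splitting off squares -/

/-- The quadratic form of `M` takes nonnegative values at `0⁺` on polynomial vectors. -/
def QuadNonneg (M : Matrix (Fin n) (Fin n) ℝ[X]) : Prop :=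
  ∀ u : Fin n → ℝ[X], NonnegAtZeroPlus (u ⬝ᵥ M *ᵥ u)

theorem dotProduct_mulVec_comm {M : Matrix (Fin n) (Fin n) ℝ[X]} (hM : M.IsSymm)
    (u v : Fin n → ℝ[X]) : u ⬝ᵥ M *ᵥ v = v ⬝ᵥ M *ᵥ u := by
  rw [dotProduct_mulVec, ← mulVec_transpose, hM.eq, dotProduct_comm]

/-- The Cauchy–Schwarz inequality. -/
theorem QuadNonneg.cauchy_schwarz {M : Matrix (Fin n) (Fin n) ℝ[X]} (hM : M.IsSymm)
    (h : QuadNonneg M) {v : Fin n → ℝ[X]} (hv : v ⬝ᵥ M *ᵥ v ≠ 0) (u : Fin n → ℝ[X]) :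
    NonnegAtZeroPlus ((v ⬝ᵥ M *ᵥ v) * (u ⬝ᵥ M *ᵥ u) - (u ⬝ᵥ M *ᵥ v) ^ 2) := by
  refine (h v).of_mul hv ?_
  convert h ((v ⬝ᵥ M *ᵥ v) • u - (u ⬝ᵥ M *ᵥ v) • v) using 1
  simp only [mulVec_sub, mulVec_smul, sub_dotProduct, dotProduct_sub, smul_dotProduct,
    dotProduct_smul, smul_eq_mul, dotProduct_mulVec_comm hM v u]
  ring

/-- Induction on `m = n + 1 - k`, where `k` counts independent kernel vectors already found. The
case `m = 0` is vacuous: `n + 1` vectors in rank `n` are dependent. -/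
theorem exists_coprime_smul_hasSemiCertificate {f : ℝ[X]} (hf : f ≠ 0) (hXf : X ∣ f) :
    ∀ (m k : ℕ) (M : Matrix (Fin n) (Fin n) ℝ[X]) (e : Fin k → Fin n → ℝ[X]),
      k + m = n + 1 → M.IsSymm → QuadNonneg M → LinearIndependent ℝ[X] e →
      (∀ i, M *ᵥ e i = 0) →
      ∃ g, NonnegAtZeroPlus g ∧ IsCoprime g f ∧ HasSemiCertificateAtZeroPlus (g • M) := by
  intro m
  induction m with
  | zero =>
    intro k M e hk _ _ he _
    have := he.fintype_card_le_finrank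
    simp at this
    omega
  | succ m ih =>
    intro k M e hk hM hpos he hker
    by_cases hM0 : M = 0
    · subst hM0
      exact ⟨1, by simp [NonnegAtZeroPlus], isCoprime_one_left, by simpa using .zero⟩
    obtain ⟨d, M', hd0, hd, rfl, hprim⟩ : ∃ (d : ℝ[X]) (M' : Matrix (Fin n) (Fin n) ℝ[X]),
        d ≠ 0 ∧ NonnegAtZeroPlus d ∧ M = d • M' ∧ ∀ p, Prime p → ∃ i j, ¬ p ∣ M' i j := by
      obtain ⟨d, M', hd0, hMd, hprim⟩ := exists_eq_smul_primitive hM0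
      rcases nonnegAtZeroPlus_or_neg d with hd | hd
      · exact ⟨d, M', hd0, hd, hMd, hprim⟩
      · exact ⟨-d, -M', neg_ne_zero.2 hd0, hd, by simpa using hMd, by simpa using hprim⟩
    have hM' : M'.IsSymm := by
      refine Matrix.IsSymm.ext fun i j => mul_left_cancel₀ hd0 ?_
      simpa using hM.apply i j
    obtain ⟨v, hv⟩ := exists_isCoprime_dotProduct_mulVec hM' hprim hf
    set q := v ⬝ᵥ M' *ᵥ v with hq
    have hq0 : q ≠ 0 := by
      intro h0
      -- Here `X ∣ f` matters: `0` is coprime only to units.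
      rw [h0, isCoprime_zero_left] at hv
      exact not_isUnit_X (isUnit_of_dvd_unit hXf hv)
    have hdq : v ⬝ᵥ (d • M') *ᵥ v = d * q := by simp [smul_mulVec, hq]
    have hqT : NonnegAtZeroPlus q := hd.of_mul hd0 (hdq ▸ hpos v)
    set w := M' *ᵥ v with hw
    set N := q • (d • M') - d • Matrix.vecMulVec w w with hN
    have hNv : ∀ u, N *ᵥ u = q • (d • (M' *ᵥ u)) - d • ((w ⬝ᵥ u) • w) := fun u => by
      simp [hN, sub_mulVec, smul_mulVec, vecMulVec_mulVec]
    have hwu : ∀ u, w ⬝ᵥ u = v ⬝ᵥ M' *ᵥ u := fun u => by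
      rw [hw, dotProduct_comm, dotProduct_mulVec_comm hM']
    have hM'e : ∀ i, M' *ᵥ e i = 0 := fun i => by
      have := hker i
      rw [smul_mulVec] at this
      exact (smul_eq_zero.1 this).resolve_left hd0
    obtain ⟨g, hg, hgf, hgN⟩ := ih (k + 1) N (Fin.cons v e) (by omega)
      (by
        refine Matrix.IsSymm.ext fun i j => ?_
        simp only [hN, Matrix.sub_apply, Matrix.smul_apply, vecMulVec_apply, smul_eq_mul, hM'.apply i j]
        ring)
      (by
        intro u
        -- `d` times `uᵀNu` is the Cauchy–Schwarz expression for `d • M'`.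
        refine hd.of_mul hd0 ?_
        have hcs := hpos.cauchy_schwarz hM (v := v) (by rw [hdq]; exact mul_ne_zero hd0 hq0) u
        convert hcs using 1
        rw [hdq, hNv]
        simp only [smul_mulVec, dotProduct_sub, dotProduct_smul, smul_eq_mul, hwu,
          dotProduct_mulVec_comm hM' v u]
        rw [← hw]
        ring)
      (by
        -- Pairing a relation `c • v + y = 0` with `vᵀM'` leaves `c * q = 0`.
        refine he.finCons' v e fun c y hyS hy => ?_
        have hMy : M' *ᵥ y = 0 := by
          have hle : Submodule.span ℝ[X] (Set.range e) ≤ LinearMap.ker M'.mulVecLin := by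
            rw [Submodule.span_le]
            rintro _ ⟨i, rfl⟩
            simpa using hM'e i
          simpa using hle hyS
        have h0 : v ⬝ᵥ M' *ᵥ (c • v + y) = c * q := by
          simp [mulVec_add, mulVec_smul, hMy, hq, hw]
        rw [hy] at h0
        simpa [hq0] using h0.symm)
      (by
        intro i
        rw [hNv]
        refine Fin.cases ?_ (fun i => ?_) i
        · rw [Fin.cons_zero, hwu, ← hw, ← hq, smul_comm]
          exact sub_self _
        · simp [hwu, hM'e])
    refine ⟨g * q, hg.mul hqT, hgf.mul_left hv, ?_⟩
    have hsplit : (g * q) • (d • M') = g • N + (g * d) • Matrix.vecMulVec w w := by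
      rw [hN, smul_sub, mul_smul, mul_smul g d]
      simp
    rw [hsplit]
    exact hgN.add ((HasSemiCertificateAtZeroPlus.vecMulVec w).smul (hg.mul hd))

theorem QuadNonneg.hasSemiCertificateAtZeroPlus {M : Matrix (Fin n) (Fin n) ℝ[X]}
    (hM : M.IsSymm) (hpos : QuadNonneg M) : HasSemiCertificateAtZeroPlus M := by
  have main : ∀ f : ℝ[X], f ≠ 0 → X ∣ f →
      ∃ g, NonnegAtZeroPlus g ∧ IsCoprime g f ∧ HasSemiCertificateAtZeroPlus (g • M) :=
    fun f hf hX => exists_coprime_smul_hasSemiCertificate hf hX (n + 1) 0 M Fin.elim0 (by omega)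
      hM hpos linearIndependent_empty_type fun i => i.elim0
  have eval_ne : ∀ p f : ℝ[X], X ∣ f → IsCoprime p f → p.eval 0 ≠ 0 := by
    intro p f hX hp h0
    have hXp : X ∣ p := X_dvd_iff.2 (by rwa [coeff_zero_eq_eval_zero])
    exact not_isUnit_X (hp.isUnit_of_dvd' hXp hX)
  obtain ⟨g, hg, hgX, hgM⟩ := main X X_ne_zero dvd_rfl
  have hg0 := eval_ne g X dvd_rfl hgX
  -- The factor `g` makes `h` prime to `g`; the factor `X` keeps `h(0) ≠ 0`.
  obtain ⟨h, hh, hhX, hhM⟩ := main (X * g)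
    (mul_ne_zero X_ne_zero (by rintro rfl; simp at hg0)) (dvd_mul_right _ _)
  have hh0 := eval_ne h _ (dvd_mul_right _ _) hhX
  obtain ⟨a, b, ha, hb, hab⟩ := exists_bezout_nonneg hhX.of_mul_right_right.symm
    (hg.eval_zero_pos hg0) (hh.eval_zero_pos hh0)
  have hsum := (hgM.smul ha).add (hhM.smul hb)
  rwa [smul_smul, smul_smul, ← add_smul, hab, one_smul] at hsum

theorem IsPsdOn.quadNonneg {M : Matrix (Fin n) (Fin n) ℝ[X]} {V : Set ℝ}
    (hV : V ∈ 𝓝[>] (0 : ℝ)) (h : IsPsdOn M V) : QuadNonneg M := by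
  intro u
  filter_upwards [hV] with t ht
  have := (h t ht).dotProduct_mulVec_nonneg fun i => (u i).eval t
  simpa [dotProduct, mulVec, evalAt, eval_finsetSum] using this

end MatrixPolynomial

theorem mainTheorem3 (n : ℕ) (M : Matrix (Fin n) (Fin n) ℝ[X]) (hM : M.IsSymm)
    (hpsd : ∃ V ∈ 𝓝[>] (0 : ℝ), MatrixPolynomial.IsPsdOn M V) :
    MatrixPolynomial.HasSemiCertificateAtZeroPlus M := by
  obtain ⟨V, hV, h⟩ := hpsd
  exact (h.quadNonneg hV).hasSemiCertificateAtZeroPlus hM
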